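/- Let $M$ be a smooth manifold of dimension $n$, let $A^k(M)=\Gamma(\wedge^kTM)$ (with $A^0(M)=C^\infty(M)$ and $A^{-1}(M)=0$), let $\mathcal A(M)=\bigoplus_{k\ge 0}A^k(M)$, and let $[\cdot,\cdot]$ denote the Schouten–Nijenhuis bracket of multivector fields. A *higher connection* on $M$ is a map $\nabla:\mathcal A(M)\times\mathcal A(M)\to\mathcal A(M)$, $(X,Y)\mapsto\nabla_XY$, such that 1. $\nabla_XY\in A^{k+l-1}(M)$ for $X\in A^k(M)$, $Y\in A^l(M)$; 2. $\nabla_{fX+X'}Y=f\nabla_XY+\nabla_{X'}Y$ and $\nabla_X(Y+Y')=\nabla_XY+\nabla_XY'$ for $X,X',Y,Y'\in\mathcal A(M)$, $f\in C^\infty(M)$; 3. $\nabla_Xf=[X,f]$ and $\nabla_X(fY)=[X,f]\wedge Y+f\nabla_XY$ for $X\in A^k(M)$, $f\in C^\infty(M)$, $Y\in\mathcal A(M)$; 4. $\nabla_fX=0$ for $f\in C^\infty(M)$, $X\in\mathcal A(M)$. It is *upper induced* if $$\nabla_X(Y\wedge Z)=(\nabla_XY)\wedge Z+(-1)^{(k-1)l}\,Y\wedge\nabla_XZ,$$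 and *lower induced* if $$\nabla_{X\wedge Y}Z=X\wedge\nabla_YZ+(-1)^{kl}\,Y\wedge\nabla_XZ,$$ in each case for all $k,l\ge 0$, $X\in A^k(M)$, $Y\in A^l(M)$, $Z\in\mathcal A(M)$. It is *induced by* an affine connection $D$ on $TM$ if it is both upper and lower induced and $\nabla_XY=D_XY$ for all vector fields $X,Y$. It is *torsion-free* if $$\nabla_XY-(-1)^{(k-1)(l-1)}\nabla_YX-[X,Y]=0\qquad\text{for all }k,l\ge 0,\ X\in A^k(M),\ Y\in A^l(M).$$ A pair $(D,\{F^{k,l}\})$ is *associated* to $\nabla$ if $D$ is an affine connection on $TM$ and the $F^{k,l}$ (the *twist fields*) are smooth sections of $\wedge^{k+l-1}TM\otimes\wedge^kT^*M\otimes\wedge^lT^*M$ for $k,l\ge 1$, with $F^{1,1}=0$ and the convention $F^{k,l}=0$ if $kl=0$, such that $\nabla_XY=\widetilde D_XY+F^{k,l}(X,Y)$ for all $X\in A^k(M)$, $Y\in A^l(M)$, where $\widetilde D$ is the higher connection induced by $D$. **Corollary.** Let $\nabla$ be a torsion-free higher connection on $M$ that is upper induced or lower induced. Then there is an affine connection $D$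 on $TM$, torsion-free in the usual sense ($D_XY-D_YX=[X,Y]$ for all vector fields $X,Y$), such that $\nabla$ is induced by $D$. Moreover, a pair $(D',\{F^{k,l}\})$ is associated to $\nabla$ if and only if $D'=D$ and $F^{k,l}=0$ for all $k,l$; that is, all twist fields of $\nabla$ vanish. -/

import Mathlib

open scoped Manifold ContDiff Bundle

noncomputable section

namespace HigherConn

/-! ### Multivectors and multivector fields on an `n`-dimensional smooth manifold -/

/-- The full exterior algebra `⋀ T_pM` of the tangent space at `p`. -/
abbrev Multivector (n : ℕ) {M : Type*} [TopologicalSpace M]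
    [ChartedSpace (EuclideanSpace ℝ (Fin n)) M] (p : M) : Type :=
  ExteriorAlgebra ℝ (TangentSpace (𝓡 n) p)

/-- A not necessarily smooth section of the bundle `⋀ TM`. -/
abbrev RoughField (n : ℕ) (M : Type*) [TopologicalSpace M]
    [ChartedSpace (EuclideanSpace ℝ (Fin n)) M] : Type _ :=
  ∀ p : M, Multivector n p

section

variable {n : ℕ} {M : Type*} [TopologicalSpace M]
  [ChartedSpace (EuclideanSpace ℝ (Fin n)) M] [IsManifold (𝓡 n) ∞ M]

/-- The value at `q` of the section `P`, read in the trivialization of `⋀ TM` that is induced by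
the preferred chart at `p₀` (meaningful for `q` in the domain of that chart). -/
def localRep (p₀ : M) (P : RoughField n M) (q : M) :
    ExteriorAlgebra ℝ (EuclideanSpace ℝ (Fin n)) :=
  ExteriorAlgebra.map
    ((trivializationAt (EuclideanSpace ℝ (Fin n)) (TangentSpace (𝓡 n) : M → Type) p₀).linearMapAt
      ℝ q) (P q)

/-- The standard basis `e_S`, `S ⊆ {0, …, n-1}`, of the exterior algebra of `ℝⁿ`. -/
def extBasis (n : ℕ) :
    Module.Basis (Finset (Fin n)) ℝ (ExteriorAlgebra ℝ (EuclideanSpace ℝ (Fin n))) :=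
  (EuclideanSpace.basisFun (Fin n) ℝ).toBasis.ExteriorAlgebra

/-- A section of `⋀ TM` is smooth if in each chart all its components are smooth functions. -/
def IsSmooth (P : RoughField n M) : Prop :=
  ∀ (p₀ : M) (S : Finset (Fin n)),
    ContMDiffOn (𝓡 n) 𝓘(ℝ, ℝ) ∞ (fun q => (extBasis n).coord S (localRep p₀ P q))
      (chartAt (EuclideanSpace ℝ (Fin n)) p₀).source

end

/-- `𝒜(M)`: the `ℝ`-algebra, under the wedge product, of smooth sections of `⋀ TM`. -/
def MV (n : ℕ) (M : Type*) [TopologicalSpace M]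
    [ChartedSpace (EuclideanSpace ℝ (Fin n)) M] [IsManifold (𝓡 n) ∞ M] :
    Subalgebra ℝ (RoughField n M) where
  carrier := {P | IsSmooth P}
  mul_mem' := by
    intro P Q hP hQ p₀ S
    have h : (fun q => (extBasis n).coord S (localRep p₀ (P * Q) q)) = fun q =>
        ∑ A, ∑ B, ((extBasis n).coord A (localRep p₀ P q) *
          (extBasis n).coord B (localRep p₀ Q q)) *
          (extBasis n).coord S (extBasis n A * extBasis n B) := by
      funext q
      have e : localRep p₀ (P * Q) q = localRep p₀ P q * localRep p₀ Q q := by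
        simp [localRep]
      rw [e]
      conv_lhs => rw [← (extBasis n).sum_repr (localRep p₀ P q),
        ← (extBasis n).sum_repr (localRep p₀ Q q)]
      rw [Finset.sum_mul_sum]
      simp only [map_sum, smul_mul_smul_comm, map_smul, smul_eq_mul, Module.Basis.coord_apply]
    rw [h]
    exact contMDiffOn_finsetSum fun A _ => contMDiffOn_finsetSum fun B _ =>
      ((hP p₀ A).mul (hQ p₀ B)).mul contMDiffOn_const
  add_mem' := by
    intro P Q hP hQ p₀ S
    have h : (fun q => (extBasis n).coord S (localRep p₀ (P + Q) q)) = fun q =>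
        (extBasis n).coord S (localRep p₀ P q) + (extBasis n).coord S (localRep p₀ Q q) := by
      funext q
      simp [localRep]
    rw [h]
    exact (hP p₀ S).add (hQ p₀ S)
  algebraMap_mem' := by
    intro r p₀ S
    have h : (fun q => (extBasis n).coord S
        (localRep p₀ (algebraMap ℝ (RoughField n M) r) q)) = fun _ =>
        (extBasis n).coord S (algebraMap ℝ _ r) := by
      funext q
      simp [localRep, Pi.algebraMap_apply]
    rw [h]
    exact contMDiffOn_const

/-- Smooth real functions on `M`. -/
abbrev Fun (n : ℕ) (M : Type*) [TopologicalSpace M]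
    [ChartedSpace (EuclideanSpace ℝ (Fin n)) M] : Type _ :=
  C^∞⟮𝓡 n, M; 𝓘(ℝ, ℝ), ℝ⟯

/-- Smooth vector fields on `M`. -/
abbrev VF (n : ℕ) (M : Type*) [TopologicalSpace M]
    [ChartedSpace (EuclideanSpace ℝ (Fin n)) M] [IsManifold (𝓡 n) ∞ M] : Type _ :=
  Cₛ^∞⟮𝓡 n; EuclideanSpace ℝ (Fin n), (TangentSpace (𝓡 n) : M → Type)⟯

section

variable {n : ℕ} {M : Type*} [TopologicalSpace M]
  [ChartedSpace (EuclideanSpace ℝ (Fin n)) M] [IsManifold (𝓡 n) ∞ M]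

/-- A smooth function as a multivector field of degree `0`; the product `f X` of a function and a
multivector field is `ofFun f * X`. -/
def ofFun (f : Fun n M) : MV n M :=
  ⟨fun p => algebraMap ℝ (Multivector n p) (f p), by
    intro p₀ S
    have h : (fun q => (extBasis n).coord S (localRep p₀
        (fun p => algebraMap ℝ (Multivector n p) (f p)) q)) = fun q =>
        f q * (extBasis n).coord S 1 := by
      funext q
      simp only [localRep, AlgHom.commutes]
      rw [Algebra.algebraMap_eq_smul_one, map_smul, smul_eq_mul]
    rw [h]
    exact f.contMDiff.contMDiffOn.mul contMDiffOn_const⟩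

/-- A smooth vector field as a multivector field of degree `1`. -/
def ofVF (X : VF n M) : MV n M :=
  ⟨fun p => ExteriorAlgebra.ι ℝ (X p), by
    intro p₀ S
    have h : (fun q => (extBasis n).coord S (localRep p₀
        (fun p => ExteriorAlgebra.ι ℝ (X p)) q)) = fun q =>
        (((extBasis n).coord S) ∘ₗ (ExteriorAlgebra.ι ℝ)).toContinuousLinearMap
          ((trivializationAt (EuclideanSpace ℝ (Fin n))
            (TangentSpace (𝓡 n) : M → Type) p₀).linearMapAt ℝ q (X q)) := by
      funext q
      simp [localRep]
    rw [h]
    have hX : ContMDiffOn (𝓡 n) 𝓘(ℝ, EuclideanSpace ℝ (Fin n)) ∞ (fun q =>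
        (trivializationAt (EuclideanSpace ℝ (Fin n))
            (TangentSpace (𝓡 n) : M → Type) p₀).linearMapAt ℝ q (X q))
        (chartAt (EuclideanSpace ℝ (Fin n)) p₀).source := by
      have h1 := ((trivializationAt (EuclideanSpace ℝ (Fin n))
        (TangentSpace (𝓡 n) : M → Type) p₀).contMDiffOn_section_baseSet_iff (IB := 𝓡 n)
          (n := ∞) (s := fun q => X q)).1 X.contMDiff.contMDiffOn
      refine h1.congr fun q hq => ?_
      rw [Bundle.Trivialization.coe_linearMapAt_of_mem _ hq]
    exact (ContinuousLinearMap.contMDiff _).comp_contMDiffOn hX⟩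

/-- `X ∈ A^k(M)`: the multivector field `X` is a section of `⋀^k TM`. -/
def IsKVector (k : ℕ) (X : MV n M) : Prop :=
  ∀ p : M, X.1 p ∈ ⋀[ℝ]^k (TangentSpace (𝓡 n) p)

/-! ### The Schouten-Nijenhuis bracket -/

/-- The partial derivative `∂P/∂xⁱ` at `p`, computed componentwise in the preferred chart at `p`. -/
def partialDeriv (i : Fin n) (P : RoughField n M) (p : M) :
    ExteriorAlgebra ℝ (EuclideanSpace ℝ (Fin n)) :=
  ∑ S : Finset (Fin n),
    (fderiv ℝ (fun y => (extBasis n).coord S (localRep p P ((extChartAt (𝓡 n) p).symm y)))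
      (extChartAt (𝓡 n) p p) (EuclideanSpace.single i 1)) • extBasis n S

/-- The coordinate form `dxⁱ` on `ℝⁿ`. -/
def coordForm (n : ℕ) (i : Fin n) : Module.Dual ℝ (EuclideanSpace ℝ (Fin n)) :=
  (EuclideanSpace.basisFun (Fin n) ℝ).toBasis.coord i

/-- The Schouten-Nijenhuis bracket of multivector fields, by the usual coordinate formula
`[P, Q] = ∑ᵢ (P ⌊ dxⁱ) ∧ ∂ᵢQ - ∂ᵢP ∧ (dxⁱ ⌋ Q)`. Here `⌊` and `⌋` are the interior products with a
covector from the right and from the left: `(P ∧ v) ⌊ d = d(v) P - (P ⌊ d) ∧ v` and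
`d ⌋ (v ∧ Q) = d(v) Q - v ∧ (d ⌋ Q)`. The right hand side does not depend on the chart.
For vector fields it is the Lie bracket, `[X, f] = X f` for a vector field `X` and a function `f`,
and `[P, Q ∧ R] = [P, Q] ∧ R + (-1)^((p-1)q) Q ∧ [P, R]` for `P`, `Q` of degrees `p`, `q`. -/
def schouten (P Q : RoughField n M) : RoughField n M := fun p =>
  ExteriorAlgebra.map
    ((trivializationAt (EuclideanSpace ℝ (Fin n)) (TangentSpace (𝓡 n) : M → Type) p).symmₗ ℝ p)
    (∑ i : Fin n,
      (CliffordAlgebra.contractRight (localRep p P p) (coordForm n i) * partialDeriv i Q p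
        - partialDeriv i P p * CliffordAlgebra.contractLeft (coordForm n i) (localRep p Q p)))

/-- The sign `(-1)^a`. -/
def sgn (a : ℤ) : ℝ := (-1 : ℝ) ^ a

end

/-! ### Higher connections and affine connections -/

/-- A higher affine connection on `M`. In `degree` the case `k = l = 0` is left out, where
`A^(-1)(M) = 0` and the condition is contained in `fun_left`. -/
structure HigherConnection (n : ℕ) (M : Type*) [TopologicalSpace M]
    [ChartedSpace (EuclideanSpace ℝ (Fin n)) M] [IsManifold (𝓡 n) ∞ M] where
  /-- `∇ X Y = ∇_X Y` -/
  nabla : MV n M → MV n M → MV n M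
  degree : ∀ (k l : ℕ) (X Y : MV n M), IsKVector k X → IsKVector l Y → 0 < k + l →
    IsKVector (k + l - 1) (nabla X Y)
  linear_left : ∀ (f : Fun n M) (X X' Y : MV n M),
    nabla (ofFun f * X + X') Y = ofFun f * nabla X Y + nabla X' Y
  add_right : ∀ X Y Y' : MV n M, nabla X (Y + Y') = nabla X Y + nabla X Y'
  fun_right : ∀ (k : ℕ) (X : MV n M) (f : Fun n M), IsKVector k X →
    (nabla X (ofFun f) : RoughField n M) = schouten X (ofFun f)
  leibniz : ∀ (k : ℕ) (X : MV n M) (f : Fun n M) (Y : MV n M), IsKVector k X →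
    (nabla X (ofFun f * Y) : RoughField n M) =
      schouten X (ofFun f) * (Y : RoughField n M) + ((ofFun f * nabla X Y : MV n M) : RoughField n M)
  fun_left : ∀ (f : Fun n M) (X : MV n M), nabla (ofFun f) X = 0

/-- An affine connection on `TM`, as an operator on smooth vector fields. -/
structure AffineConnection (n : ℕ) (M : Type*) [TopologicalSpace M]
    [ChartedSpace (EuclideanSpace ℝ (Fin n)) M] [IsManifold (𝓡 n) ∞ M] where
  /-- `D X Y = D_X Y` -/
  nabla : VF n M → VF n M → VF n M
  add_left : ∀ X X' Y : VF n M, nabla (X + X') Y = nabla X Y + nabla X' Y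
  smul_left : ∀ (f : Fun n M) (X fX Y : VF n M), (∀ p, fX p = f p • X p) →
    ∀ p, nabla fX Y p = f p • nabla X Y p
  add_right : ∀ X Y Y' : VF n M, nabla X (Y + Y') = nabla X Y + nabla X Y'
  leibniz : ∀ (f : Fun n M) (X Y fY : VF n M), (∀ p, fY p = f p • Y p) →
    ∀ p, nabla X fY p =
      (show ℝ from mfderiv (𝓡 n) 𝓘(ℝ, ℝ) f p (X p)) • Y p + f p • nabla X Y p

section

variable {n : ℕ} {M : Type*} [TopologicalSpace M]
  [ChartedSpace (EuclideanSpace ℝ (Fin n)) M] [IsManifold (𝓡 n) ∞ M]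

/-- Vanishing of the usual torsion `D_X Y - D_Y X - [X, Y]`. -/
def AffineConnection.IsTorsionFree (D : AffineConnection n M) : Prop :=
  ∀ (X Y : VF n M) (p : M),
    D.nabla X Y p - D.nabla Y X p - VectorField.mlieBracket (𝓡 n) X Y p = 0

namespace HigherConnection

/-- The higher torsion `T(X, Y)` for `X ∈ A^k(M)` and `Y ∈ A^l(M)`. -/
def torsion (C : HigherConnection n M) (k l : ℕ) (X Y : MV n M) : RoughField n M :=
  (C.nabla X Y : RoughField n M)
    - sgn (((k : ℤ) - 1) * ((l : ℤ) - 1)) • (C.nabla Y X : RoughField n M) - schouten X Y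

def IsTorsionFree (C : HigherConnection n M) : Prop :=
  ∀ (k l : ℕ) (X Y : MV n M), IsKVector k X → IsKVector l Y → C.torsion k l X Y = 0

def IsUpperInduced (C : HigherConnection n M) : Prop :=
  ∀ (k l : ℕ) (X Y Z : MV n M), IsKVector k X → IsKVector l Y →
    C.nabla X (Y * Z) =
      C.nabla X Y * Z + sgn (((k : ℤ) - 1) * (l : ℤ)) • (Y * C.nabla X Z)

def IsLowerInduced (C : HigherConnection n M) : Prop :=
  ∀ (k l : ℕ) (X Y Z : MV n M), IsKVector k X → IsKVector l Y →
    C.nabla (X * Y) Z =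
      X * C.nabla Y Z + sgn ((k : ℤ) * (l : ℤ)) • (Y * C.nabla X Z)

/-- `C` is the higher connection induced by the affine connection `D`: it is induced, i.e. satisfies
both product rules, and it restricts to `D` on vector fields. -/
def IsInducedBy (C : HigherConnection n M) (D : AffineConnection n M) : Prop :=
  C.IsLowerInduced ∧ C.IsUpperInduced ∧
    ∀ X Y : VF n M, C.nabla (ofVF X) (ofVF Y) = ofVF (D.nabla X Y)

end HigherConnection

end

/-- A collection of smooth sections `F^{k,l}` of `⋀^{k+l-1} TM ⊗ ⋀^k T*M ⊗ ⋀^l T*M`, i.e. of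
bilinear maps `⋀^k T_pM × ⋀^l T_pM → ⋀^{k+l-1} T_pM` depending smoothly on `p`, with `F^{1,1} = 0`,
and with the convention `F^{k,l} = 0` if `k = 0` or `l = 0`. (If `k + l - 1 > n`, then
`⋀^{k+l-1} T_pM = 0`.) -/
structure TwistData (n : ℕ) (M : Type*) [TopologicalSpace M]
    [ChartedSpace (EuclideanSpace ℝ (Fin n)) M] [IsManifold (𝓡 n) ∞ M] where
  twist : ∀ (k l : ℕ) (p : M), ⋀[ℝ]^k (TangentSpace (𝓡 n) p) →ₗ[ℝ]
    ⋀[ℝ]^l (TangentSpace (𝓡 n) p) →ₗ[ℝ] ⋀[ℝ]^(k + l - 1) (TangentSpace (𝓡 n) p)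
  smooth : ∀ (k l : ℕ) (X Y : MV n M) (hX : IsKVector k X) (hY : IsKVector l Y),
    IsSmooth (fun p : M =>
      (twist k l p ⟨X.1 p, hX p⟩ ⟨Y.1 p, hY p⟩ : Multivector n p))
  one_one : ∀ p : M, twist 1 1 p = 0
  zero_left : ∀ (l : ℕ) (p : M), twist 0 l p = 0
  zero_right : ∀ (k : ℕ) (p : M), twist k 0 p = 0

/-- The pair `(D, F)` of an affine connection and twist fields is associated to the higher
connection `C`: `C_X Y = D_X Y + F^{k,l}(X, Y)` for `X ∈ A^k(M)` and `Y ∈ A^l(M)`, where `D_X Y`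
is formed with the higher connection induced by `D`. -/
def HigherConnection.IsAssociated {n : ℕ} {M : Type*} [TopologicalSpace M]
    [ChartedSpace (EuclideanSpace ℝ (Fin n)) M] [IsManifold (𝓡 n) ∞ M]
    (C : HigherConnection n M) (D : AffineConnection n M) (F : TwistData n M) : Prop :=
  ∃ C' : HigherConnection n M, C'.IsInducedBy D ∧
    ∀ (k l : ℕ) (X Y : MV n M) (hX : IsKVector k X) (hY : IsKVector l Y) (p : M),
      (C.nabla X Y).1 p =
        (C'.nabla X Y).1 p + (F.twist k l p ⟨X.1 p, hX p⟩ ⟨Y.1 p, hY p⟩ : Multivector n p)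

end HigherConn

end

noncomputable section

namespace HigherConn

/-! Torsion-freeness expresses `∇_X Y` through `∇_Y X` and the bracket `[X, Y]`. The bracket obeys a
graded Leibniz rule in its first argument (`schouten_mul_left`), so a product rule for `∇` in one
slot is carried to the other slot. Expand the torsion identity for a pair whose first entry is a
wedge product, insert the Leibniz rule and the known product rule, and use graded commutativity: the
unwanted terms cancel in pairs (`lower_identity`, `upper_identity`). Hence `∇` is both upper and
lower induced.

The restriction of `∇` to vector fields is then an affine connection `D` inducing `∇`. Its axioms
and its torsion-freeness come from those of `∇`, because the bracket is `X f` on a vector field and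
a function (`schouten_ofVF_ofFun`) and the Lie bracket on two vector fields (`schouten_ofVF_ofVF`).

For uniqueness, `F^{1,1} = 0` makes the higher connection induced by `D'` agree with `∇` on vector
fields, so `D' = D`. Both are determined on wedge products of vector fields by the two product rules
(`nabla_prod_eq`). The values of such products span each exterior power of `T_pM`, and the twist
fields act pointwise, so they vanish (`twist_eq_zero`). -/

theorem sgn_add (a b : ℤ) : sgn (a + b) = sgn a * sgn b :=
  zpow_add₀ (by norm_num) a b

theorem sgn_congr {a b : ℤ} (h : Even (a - b)) : sgn a = sgn b := by
  have : a = (a - b) + b := by ring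
  rw [this, sgn_add, sgn, h.neg_one_zpow, one_mul]

theorem sgn_mul_self (a : ℤ) : sgn a * sgn a = 1 := by
  rw [← sgn_add, sgn, (Even.neg_one_zpow ⟨a, rfl⟩)]

/-! ### Exterior algebra of a vector space: graded signs, contractions, degrees -/

section Exterior

variable {V W : Type*} [AddCommGroup V] [Module ℝ V] [AddCommGroup W] [Module ℝ W]

theorem ι_mul_eq_sgn_smul (a : V) {l : ℕ} {y : ExteriorAlgebra ℝ V} (hy : y ∈ ⋀[ℝ]^l V) :
    ExteriorAlgebra.ι ℝ a * y = sgn l • (y * ExteriorAlgebra.ι ℝ a) := by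
  induction hy using Submodule.pow_induction_on_left' with
  | algebraMap r => simp [sgn, Algebra.commutes]
  | add x y i hx hy ihx ihy => rw [mul_add, ihx, ihy, add_mul, smul_add]
  | mem_mul m hm i x hx ih =>
    obtain ⟨b, rfl⟩ := hm
    have h := eq_neg_of_add_eq_zero_left (ExteriorAlgebra.ι_add_mul_swap (R := ℝ) a b)
    rw [← mul_assoc, h, neg_mul, mul_assoc, ih, mul_smul_comm, ← mul_assoc, ← neg_smul]
    congr 1
    push_cast
    rw [sgn_add]; simp [sgn]

theorem mul_eq_sgn_smul {k l : ℕ} {x y : ExteriorAlgebra ℝ V} (hx : x ∈ ⋀[ℝ]^k V)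
    (hy : y ∈ ⋀[ℝ]^l V) : x * y = sgn (k * l) • (y * x) := by
  induction hx using Submodule.pow_induction_on_left' with
  | algebraMap r => simp [sgn, Algebra.commutes]
  | add x y i hx hy ihx ihy => rw [add_mul, ihx, ihy, mul_add, smul_add]
  | mem_mul m hm i x hx ih =>
    obtain ⟨b, rfl⟩ := hm
    rw [mul_assoc, ih, mul_smul_comm, ← mul_assoc, ι_mul_eq_sgn_smul b hy, smul_mul_assoc,
      smul_smul, mul_assoc, ← sgn_add]
    congr 2
    push_cast
    ring

open CliffordAlgebra in
-- The covector enters from the right and must pass all `l` factors of `y` to reach `x`. The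
-- induction splits vectors off `y` on the right, matching the recursion of `contractRight`.
theorem contractRight_mul (d : Module.Dual ℝ V) (x : ExteriorAlgebra ℝ V) {l : ℕ}
    {y : ExteriorAlgebra ℝ V} (hy : y ∈ ⋀[ℝ]^l V) :
    contractRight (x * y) d = x * contractRight y d + sgn l • (contractRight x d * y) := by
  induction hy using Submodule.pow_induction_on_right' with
  | algebraMap r =>
    have h1 := contractRight_mul_algebraMap (Q := (0 : QuadraticForm ℝ V)) d x r
    have h2 := contractRight_algebraMap (Q := (0 : QuadraticForm ℝ V)) d r
    erw [h1, h2]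
    simp [sgn]
  | add y z i hy hz ihy ihz =>
    rw [mul_add, map_add, LinearMap.add_apply, ihy, ihz, map_add, LinearMap.add_apply, mul_add,
      mul_add, smul_add]
    abel
  | mul_mem i y hy ih m hm =>
    obtain ⟨b, rfl⟩ := hm
    have h1 := contractRight_mul_ι (Q := (0 : QuadraticForm ℝ V)) d b (x * y)
    have h2 := contractRight_mul_ι (Q := (0 : QuadraticForm ℝ V)) d b y
    rw [← mul_assoc]
    erw [h1, h2, ih]
    push_cast
    rw [sgn_add, mul_sub, mul_smul_comm, add_mul, sub_add_eq_sub_sub]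
    have e : CliffordAlgebra.ι (0 : QuadraticForm ℝ V) b = ExteriorAlgebra.ι ℝ b := rfl
    simp [sgn, mul_assoc, e, sub_eq_add_neg]

open CliffordAlgebra in
-- Degree zero is a separate clause, since truncated `m - 1` would lose the vanishing there. The
-- induction for the second clause needs that vanishing when a single vector is contracted.
theorem contractLeft_mem (d : Module.Dual ℝ V) {m : ℕ} {z : ExteriorAlgebra ℝ V}
    (hz : z ∈ ⋀[ℝ]^m V) :
    (m = 0 → contractLeft d z = 0) ∧ ∀ j, m = j + 1 → contractLeft d z ∈ ⋀[ℝ]^j V := by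
  induction hz using Submodule.pow_induction_on_left' with
  | algebraMap r =>
    exact ⟨fun _ => contractLeft_algebraMap (Q := (0 : QuadraticForm ℝ V)) d r, by simp⟩
  | add y z i hy hz ihy ihz =>
    rw [map_add]
    exact ⟨fun h => by rw [ihy.1 h, ihz.1 h, add_zero],
      fun j h => Submodule.add_mem _ (ihy.2 j h) (ihz.2 j h)⟩
  | mem_mul v hv i z hz ih =>
    obtain ⟨b, rfl⟩ := hv
    refine ⟨by simp, fun j hj => ?_⟩
    obtain rfl : i = j := by omega
    have h2 := contractLeft_ι_mul (Q := (0 : QuadraticForm ℝ V)) d b z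
    erw [h2]
    refine Submodule.sub_mem _ (Submodule.smul_mem _ _ hz) ?_
    rcases i with _ | i
    · rw [ih.1 rfl, mul_zero]; exact Submodule.zero_mem _
    · rw [ExteriorAlgebra.exteriorPower, pow_succ']
      exact Submodule.mul_mem_mul (LinearMap.mem_range_self _ b) (ih.2 i rfl)

open CliffordAlgebra in
theorem mul_contractLeft_eq_sgn_smul (d : Module.Dual ℝ V) {l m : ℕ} {y z : ExteriorAlgebra ℝ V}
    (hy : y ∈ ⋀[ℝ]^l V) (hz : z ∈ ⋀[ℝ]^m V) :
    y * contractLeft d z = sgn (l * (m - 1)) • (contractLeft d z * y) := by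
  -- For `m = 0` the integer exponent contains `-1`, but both sides are zero.
  rcases m with _ | m
  · rw [(contractLeft_mem d hz).1 rfl, mul_zero, zero_mul, smul_zero]
  · rw [mul_eq_sgn_smul hy ((contractLeft_mem d hz).2 m rfl)]
    simp

theorem map_mem_exteriorPower (f : V →ₗ[ℝ] W) {k : ℕ} {x : ExteriorAlgebra ℝ V}
    (hx : x ∈ ⋀[ℝ]^k V) : ExteriorAlgebra.map f x ∈ ⋀[ℝ]^k W := by
  induction hx using Submodule.pow_induction_on_left' with
  | algebraMap r =>
    rw [AlgHom.commutes, ExteriorAlgebra.exteriorPower, pow_zero]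
    exact Submodule.algebraMap_mem r
  | add y z i hy hz ihy ihz => rw [map_add]; exact Submodule.add_mem _ ihy ihz
  | mem_mul v hv i z hz ih =>
    obtain ⟨b, rfl⟩ := hv
    rw [map_mul, ExteriorAlgebra.map_apply_ι, ExteriorAlgebra.exteriorPower, pow_succ']
    exact Submodule.mul_mem_mul (LinearMap.mem_range_self _ _) ih

theorem mul_mem_exteriorPower {k l : ℕ} {x y : ExteriorAlgebra ℝ V}
    (hx : x ∈ ⋀[ℝ]^k V) (hy : y ∈ ⋀[ℝ]^l V) : x * y ∈ ⋀[ℝ]^(k + l) V := by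
  rw [ExteriorAlgebra.exteriorPower, pow_add]
  exact Submodule.mul_mem_mul hx hy

theorem ι_mem_exteriorPower (v : V) : ExteriorAlgebra.ι ℝ v ∈ ⋀[ℝ]^1 V := by
  rw [ExteriorAlgebra.exteriorPower, pow_one]
  exact LinearMap.mem_range_self _ v

/-- The projection of the exterior algebra onto its part of degree `k`. -/
def degreeProj (V : Type*) [AddCommGroup V] [Module ℝ V] (k : ℕ) :
    ExteriorAlgebra ℝ V →ₗ[ℝ] ExteriorAlgebra ℝ V :=
  GradedAlgebra.proj (fun i : ℕ => ⋀[ℝ]^i V) k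

theorem degreeProj_of_mem {k : ℕ} {x : ExteriorAlgebra ℝ V} (hx : x ∈ ⋀[ℝ]^k V) (j : ℕ) :
    degreeProj V j x = if k = j then x else 0 := by
  rw [degreeProj, GradedAlgebra.proj_apply, DirectSum.decompose_of_mem (fun i : ℕ => ⋀[ℝ]^i V) hx,
    DirectSum.coe_of_apply]
  split <;> rfl

theorem degreeProj_mem (k : ℕ) (x : ExteriorAlgebra ℝ V) : degreeProj V k x ∈ ⋀[ℝ]^k V := by
  rw [degreeProj, GradedAlgebra.proj_apply]
  exact SetLike.coe_mem _

theorem map_degreeProj (f : V →ₗ[ℝ] W) (k : ℕ) (x : ExteriorAlgebra ℝ V) :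
    ExteriorAlgebra.map f (degreeProj V k x) = degreeProj W k (ExteriorAlgebra.map f x) := by
  induction x using DirectSum.Decomposition.inductionOn (fun i : ℕ => ⋀[ℝ]^i V) with
  | zero => simp
  | @homogeneous i m =>
    rw [degreeProj_of_mem m.2, degreeProj_of_mem (map_mem_exteriorPower f m.2)]
    split <;> simp
  | add x y hx hy => simp only [map_add, hx, hy]

end Exterior

/-! ### Degrees in the standard basis of the exterior algebra -/

theorem extBasis_mem {n : ℕ} (S : Finset (Fin n)) :
    extBasis n S ∈ ⋀[ℝ]^S.card (EuclideanSpace ℝ (Fin n)) := by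
  rw [extBasis, ExteriorAlgebra.basis_apply_ofCard _ (rfl : S.card = S.card)]
  exact ExteriorAlgebra.ιMulti_range ℝ S.card ⟨_, rfl⟩

theorem degreeProj_extBasis {n : ℕ} (S : Finset (Fin n)) (k : ℕ) :
    degreeProj _ k (extBasis n S) = if S.card = k then extBasis n S else 0 :=
  degreeProj_of_mem (extBasis_mem S) k

theorem sum_degreeProj {n : ℕ} (x : ExteriorAlgebra ℝ (EuclideanSpace ℝ (Fin n))) :
    ∑ k ∈ Finset.range (n + 1), degreeProj _ k x = x := by
  have h : ∑ k ∈ Finset.range (n + 1), degreeProj (EuclideanSpace ℝ (Fin n)) k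
      = LinearMap.id := by
    refine (extBasis n).ext fun S => ?_
    rw [LinearMap.sum_apply]
    simp only [degreeProj_extBasis]
    rw [Finset.sum_ite_eq, if_pos, LinearMap.id_apply]
    have := S.card_le_univ
    simp at this ⊢
    omega
  simpa using congrArg (fun g => g x) h

theorem coord_eq_zero {n k : ℕ} {x : ExteriorAlgebra ℝ (EuclideanSpace ℝ (Fin n))}
    (hx : x ∈ ⋀[ℝ]^k (EuclideanSpace ℝ (Fin n))) {S : Finset (Fin n)} (hS : S.card ≠ k) :
    (extBasis n).coord S x = 0 := by
  have h : (extBasis n).coord S ∘ₗ degreeProj _ k = if S.card = k then (extBasis n).coord S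
      else 0 := by
    refine (extBasis n).ext fun T => ?_
    rw [LinearMap.comp_apply, degreeProj_extBasis]
    by_cases hT : T = S
    · subst hT; split <;> simp
    · have : (extBasis n).coord S (extBasis n T) = 0 := by
        simp [Module.Basis.coord_apply, hT]
      by_cases h1 : T.card = k <;> by_cases h2 : S.card = k <;> simp [this, h1, h2]
  have h2 := congrArg (fun g => g x) h
  simpa [degreeProj_of_mem hx, hS] using h2

/-! ### Local representatives and their partial derivatives -/

section

variable {n : ℕ} {M : Type*} [TopologicalSpace M]
  [ChartedSpace (EuclideanSpace ℝ (Fin n)) M] [IsManifold (𝓡 n) ∞ M]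

theorem localRep_mul (p q : M) (P Q : RoughField n M) :
    localRep p (P * Q) q = localRep p P q * localRep p Q q := by
  simp [localRep]

theorem localRep_ofFun (p q : M) (f : Fun n M) :
    localRep p (ofFun f : RoughField n M) q = algebraMap ℝ _ (f q) :=
  AlgHom.commutes _ _

theorem localRep_ofVF (p q : M) (X : VF n M) :
    localRep p (ofVF X : RoughField n M) q = ExteriorAlgebra.ι ℝ
      ((trivializationAt (EuclideanSpace ℝ (Fin n)) (TangentSpace (𝓡 n) : M → Type) p).linearMapAt
        ℝ q (X q)) :=
  ExteriorAlgebra.map_apply_ι _ _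

theorem localRep_mem {k : ℕ} {X : MV n M} (hX : IsKVector k X) (p q : M) :
    localRep p (X : RoughField n M) q ∈ ⋀[ℝ]^k (EuclideanSpace ℝ (Fin n)) :=
  map_mem_exteriorPower _ (hX q)

theorem contDiffAt_comp_chart_symm {n : ℕ} {M : Type*} [TopologicalSpace M]
    [ChartedSpace (EuclideanSpace ℝ (Fin n)) M] {G : Type*} [NormedAddCommGroup G] [NormedSpace ℝ G]
    {g : M → G} {p : M}
    (hg : ContMDiffAt (𝓡 n) 𝓘(ℝ, G) ∞ g p) :
    ContDiffAt ℝ ∞ (fun y => g ((extChartAt (𝓡 n) p).symm y)) (extChartAt (𝓡 n) p p) := by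
  have h := (contMDiffAt_iff.1 hg).2
  simp only [Function.comp_def, mfld_simps, contDiffWithinAt_univ] at h ⊢
  exact h

theorem differentiableAt_coord (P : MV n M) (S : Finset (Fin n)) (p : M) :
    DifferentiableAt ℝ (fun y => (extBasis n).coord S
      (localRep p (P : RoughField n M) ((extChartAt (𝓡 n) p).symm y)))
      (extChartAt (𝓡 n) p p) := by
  have h := (P.2 p S).contMDiffAt ((chartAt (EuclideanSpace ℝ (Fin n)) p).open_source.mem_nhds
    (mem_chart_source _ p))
  exact (contDiffAt_comp_chart_symm h).differentiableAt (by simp)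

/-- Coordinates of a product are bilinear in the coordinates of the factors, with the constant
structure coefficients of the basis, so the scalar product rule suffices. -/
theorem partialDeriv_mul (i : Fin n) (P Q : MV n M) (p : M) :
    partialDeriv i ((P : RoughField n M) * (Q : RoughField n M)) p =
      partialDeriv i (P : RoughField n M) p * localRep p (Q : RoughField n M) p +
      localRep p (P : RoughField n M) p * partialDeriv i (Q : RoughField n M) p := by
  refine (extBasis n).ext_elem fun S => ?_
  have key : ∀ a b : ExteriorAlgebra ℝ (EuclideanSpace ℝ (Fin n)),
      (extBasis n).coord S (a * b) = ∑ A, ∑ B, ((extBasis n).coord A a *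
          (extBasis n).coord B b) * (extBasis n).coord S (extBasis n A * extBasis n B) := by
    intro a b
    conv_lhs => rw [← (extBasis n).sum_repr a, ← (extBasis n).sum_repr b]
    rw [Finset.sum_mul_sum]
    simp only [map_sum, smul_mul_smul_comm, map_smul, smul_eq_mul, Module.Basis.coord_apply]
  have cpd : ∀ (R : RoughField n M) (A : Finset (Fin n)),
      (extBasis n).coord A (partialDeriv i R p) =
      fderiv ℝ (fun y => (extBasis n).coord A (localRep p R ((extChartAt (𝓡 n) p).symm y)))
        (extChartAt (𝓡 n) p p) (EuclideanSpace.single i 1) := by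
    intro R A
    rw [partialDeriv, Module.Basis.coord_apply, Module.Basis.repr_sum_self]
  rw [← Module.Basis.coord_apply, ← Module.Basis.coord_apply, cpd, map_add, key, key]
  simp only [cpd]
  have e : (fun y => (extBasis n).coord S (localRep p ((P : RoughField n M) * (Q : RoughField n M))
      ((extChartAt (𝓡 n) p).symm y))) = fun y => ∑ A, ∑ B,
      ((extBasis n).coord A (localRep p (P : RoughField n M) ((extChartAt (𝓡 n) p).symm y)) *
        (extBasis n).coord B (localRep p (Q : RoughField n M) ((extChartAt (𝓡 n) p).symm y))) *
        (extBasis n).coord S (extBasis n A * extBasis n B) := by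
    funext y
    rw [localRep_mul, key]
  have hd : HasFDerivAt (fun y => ∑ A, ∑ B,
      ((extBasis n).coord A (localRep p (P : RoughField n M) ((extChartAt (𝓡 n) p).symm y)) *
        (extBasis n).coord B (localRep p (Q : RoughField n M) ((extChartAt (𝓡 n) p).symm y))) *
        (extBasis n).coord S (extBasis n A * extBasis n B)) _ (extChartAt (𝓡 n) p p) :=
    HasFDerivAt.fun_sum fun A _ => HasFDerivAt.fun_sum fun B _ =>
      ((differentiableAt_coord P A p).hasFDerivAt.mul
        (differentiableAt_coord Q B p).hasFDerivAt).mul_const _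
  rw [e, hd.fderiv, ← Finset.sum_add_distrib]
  simp only [sum_apply, add_apply, smul_apply, extChartAt_to_inv, smul_eq_mul]
  refine Finset.sum_congr rfl fun A _ => ?_
  rw [← Finset.sum_add_distrib]
  refine Finset.sum_congr rfl fun B _ => ?_
  ring

theorem partialDeriv_mem {k : ℕ} {X : MV n M} (hX : IsKVector k X) (i : Fin n) (p : M) :
    partialDeriv i (X : RoughField n M) p ∈ ⋀[ℝ]^k (EuclideanSpace ℝ (Fin n)) := by
  refine Submodule.sum_mem _ fun S _ => ?_
  by_cases hS : S.card = k
  · subst hS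
    exact Submodule.smul_mem _ _ (extBasis_mem S)
  · have : (fun y => (extBasis n).coord S (localRep p (X : RoughField n M)
        ((extChartAt (𝓡 n) p).symm y))) = fun _ => 0 := by
      funext y
      exact coord_eq_zero (localRep_mem hX p _) hS
    rw [this]
    simp

theorem map_symm_localRep (P : RoughField n M) (p : M) :
    ExteriorAlgebra.map ((trivializationAt (EuclideanSpace ℝ (Fin n))
      (TangentSpace (𝓡 n) : M → Type) p).symmₗ ℝ p) (localRep p P p) = P p := by
  have h := ExteriorAlgebra.map_comp_map (R := ℝ) ((trivializationAt (EuclideanSpace ℝ (Fin n))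
      (TangentSpace (𝓡 n) : M → Type) p).linearMapAt ℝ p)
      ((trivializationAt (EuclideanSpace ℝ (Fin n))
      (TangentSpace (𝓡 n) : M → Type) p).symmₗ ℝ p)
  have h2 : ((trivializationAt (EuclideanSpace ℝ (Fin n))
      (TangentSpace (𝓡 n) : M → Type) p).symmₗ ℝ p) ∘ₗ ((trivializationAt (EuclideanSpace ℝ (Fin n))
      (TangentSpace (𝓡 n) : M → Type) p).linearMapAt ℝ p) = LinearMap.id := by
    ext v
    exact Bundle.Trivialization.symmₗ_linearMapAt _
      (FiberBundle.mem_baseSet_trivializationAt' p) v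
  rw [h2, ExteriorAlgebra.map_id] at h
  exact congrArg (fun g => g (P p)) h

/-! ### Leibniz rule for the Schouten–Nijenhuis bracket -/

/-- This is the `i`-th summand of the bracket formula, with primes standing for partial derivatives.
Both terms that need `y` moved to the right get the same sign: one collects `l` from the contraction
and `l * m` from passing `z'`, the other `l * (m - 1)` from passing the contraction of `z`. -/
theorem schouten_term_mul_left {V : Type*} [AddCommGroup V] [Module ℝ V] (d : Module.Dual ℝ V)
    {l m : ℕ} (x x' : ExteriorAlgebra ℝ V) {y y' z z' : ExteriorAlgebra ℝ V} (hy : y ∈ ⋀[ℝ]^l V)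
    (hz : z ∈ ⋀[ℝ]^m V) (hz' : z' ∈ ⋀[ℝ]^m V) :
    CliffordAlgebra.contractRight (x * y) d * z' -
        (x' * y + x * y') * CliffordAlgebra.contractLeft d z =
      x * (CliffordAlgebra.contractRight y d * z' - y' * CliffordAlgebra.contractLeft d z) +
      sgn (l * (m - 1)) • ((CliffordAlgebra.contractRight x d * z' -
        x' * CliffordAlgebra.contractLeft d z) * y) := by
  have h1 : sgn l • (CliffordAlgebra.contractRight x d * y * z') =
      sgn (l * (m - 1)) • (CliffordAlgebra.contractRight x d * z' * y) := by
    rw [mul_assoc, mul_eq_sgn_smul hy hz', mul_smul_comm, smul_smul, ← sgn_add,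
      sgn_congr (a := l + l * m) (b := l * (m - 1)) ⟨l, by ring⟩, mul_assoc]
  have h2 : x' * y * CliffordAlgebra.contractLeft d z =
      sgn (l * (m - 1)) • (x' * CliffordAlgebra.contractLeft d z * y) := by
    rw [mul_assoc, mul_contractLeft_eq_sgn_smul _ hy hz, mul_smul_comm, mul_assoc]
  rw [contractRight_mul _ _ hy, add_mul, smul_mul_assoc, h1, add_mul, h2, sub_mul, smul_sub,
    mul_sub x, mul_assoc x, mul_assoc x]
  abel

/-- The graded Leibniz rule for the Schouten-Nijenhuis bracket in its first argument. -/
theorem schouten_mul_left {l m : ℕ} (X : MV n M) {Y Z : MV n M} (hY : IsKVector l Y)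
    (hZ : IsKVector m Z) :
    schouten ((X : RoughField n M) * (Y : RoughField n M)) (Z : RoughField n M) =
      (X : RoughField n M) * schouten (Y : RoughField n M) (Z : RoughField n M) +
      sgn (l * (m - 1)) •
        (schouten (X : RoughField n M) (Z : RoughField n M) * (Y : RoughField n M)) := by
  funext p
  have hX := map_symm_localRep (X : RoughField n M) p
  have hY' := map_symm_localRep (Y : RoughField n M) p
  change schouten _ _ p = X.1 p * schouten _ _ p + sgn (l * (m - 1)) • (schouten _ _ p * Y.1 p)
  simp only [schouten]
  -- The outer factors `X p` and `Y p` are written as images of their local representatives, so that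
  -- the whole identity sits under one algebra map.
  refine Eq.trans ?_ (congrArg₂ (fun a b => a * _ + sgn (l * (m - 1)) • (_ * b)) hX hY')
  rw [← map_mul, ← map_mul, ← map_smul, ← map_add, Finset.mul_sum, Finset.sum_mul,
    Finset.smul_sum, ← Finset.sum_add_distrib]
  congr 1
  refine Finset.sum_congr rfl fun i _ => ?_
  rw [localRep_mul, partialDeriv_mul]
  exact schouten_term_mul_left _ _ _ (localRep_mem hY p p) (localRep_mem hZ p p)
    (partialDeriv_mem hZ i p)

/-! ### The bracket on vector fields and functions, in charts -/

theorem linearMapAt_self (p : M) (v : TangentSpace (𝓡 n) p) :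
    (trivializationAt (EuclideanSpace ℝ (Fin n)) (TangentSpace (𝓡 n) : M → Type) p).linearMapAt
      ℝ p v = v := by
  have h := TangentBundle.continuousLinearMapAt_trivializationAt_eq_core (I := 𝓡 n)
    (mem_chart_source (EuclideanSpace ℝ (Fin n)) p)
  have h2 := congrArg (fun g => g v) h
  exact h2.trans (tangentCoordChange_self (mem_extChartAt_source (I := 𝓡 n) p))

/-- At its own centre the preferred trivialization is the identity, under the definitional
identification of `T_pM` with `ℝⁿ`; this removes the outer map from the definition of `schouten`. -/
theorem map_symm_self (p : M) (a : ExteriorAlgebra ℝ (EuclideanSpace ℝ (Fin n))) :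
    ExteriorAlgebra.map ((trivializationAt (EuclideanSpace ℝ (Fin n))
      (TangentSpace (𝓡 n) : M → Type) p).symmₗ ℝ p) a = a := by
  have h2 : ((trivializationAt (EuclideanSpace ℝ (Fin n))
      (TangentSpace (𝓡 n) : M → Type) p).symmₗ ℝ p) = LinearMap.id := by
    ext1 v
    have := Bundle.Trivialization.symmₗ_linearMapAt (R := ℝ)
      (trivializationAt (EuclideanSpace ℝ (Fin n)) (TangentSpace (𝓡 n) : M → Type) p)
      (FiberBundle.mem_baseSet_trivializationAt' p) v
    exact (congrArg _ (linearMapAt_self p v)).symm.trans this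
  have := congrArg (fun g => g a) (ExteriorAlgebra.map_id (R := ℝ) (M := EuclideanSpace ℝ (Fin n)))
  rw [← h2] at this
  exact this

theorem sum_coordForm_smul {G : Type*} [AddCommGroup G] [Module ℝ G]
    (L : EuclideanSpace ℝ (Fin n) →ₗ[ℝ] G) (v : EuclideanSpace ℝ (Fin n)) :
    ∑ i, coordForm n i v • L (EuclideanSpace.single i 1) = L v := by
  conv_rhs => rw [← (EuclideanSpace.basisFun (Fin n) ℝ).toBasis.sum_repr v]
  simp [coordForm]

/-- A vector field read in the chart at `p`. -/
def chartRep (p : M) (X : VF n M) (y : EuclideanSpace ℝ (Fin n)) : EuclideanSpace ℝ (Fin n) :=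
  (trivializationAt (EuclideanSpace ℝ (Fin n)) (TangentSpace (𝓡 n) : M → Type) p).linearMapAt
    ℝ ((extChartAt (𝓡 n) p).symm y) (X ((extChartAt (𝓡 n) p).symm y))

theorem chartRep_self (p : M) (X : VF n M) : chartRep p X (extChartAt (𝓡 n) p p) = X p := by
  rw [chartRep, extChartAt_to_inv, linearMapAt_self]

theorem differentiableAt_chartRep (p : M) (X : VF n M) :
    DifferentiableAt ℝ (chartRep p X) (extChartAt (𝓡 n) p p) := by
  have h1 := ((trivializationAt (EuclideanSpace ℝ (Fin n))
    (TangentSpace (𝓡 n) : M → Type) p).contMDiffOn_section_baseSet_iff (IB := 𝓡 n)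
      (n := ∞) (s := fun q => X q)).1 X.contMDiff.contMDiffOn
  have h2 : ContMDiffOn (𝓡 n) 𝓘(ℝ, EuclideanSpace ℝ (Fin n)) ∞ (fun q =>
      (trivializationAt (EuclideanSpace ℝ (Fin n))
        (TangentSpace (𝓡 n) : M → Type) p).linearMapAt ℝ q (X q))
      (chartAt (EuclideanSpace ℝ (Fin n)) p).source :=
    h1.congr fun q hq => by rw [Bundle.Trivialization.coe_linearMapAt_of_mem _ hq]
  exact (contDiffAt_comp_chart_symm (h2.contMDiffAt
    ((chartAt (EuclideanSpace ℝ (Fin n)) p).open_source.mem_nhds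
    (mem_chart_source _ p)))).differentiableAt (by simp)

theorem localRep_ofVF_self (p : M) (X : VF n M) : localRep p (ofVF X : RoughField n M) p =
    ExteriorAlgebra.ι ℝ (chartRep p X (extChartAt (𝓡 n) p p)) := by
  rw [localRep_ofVF, chartRep, extChartAt_to_inv]

theorem mfderiv_apply_eq_chartRep (f : Fun n M) (X : VF n M) (p : M) :
    mfderiv (𝓡 n) 𝓘(ℝ, ℝ) f p (X p) =
      fderiv ℝ (fun y => f ((extChartAt (𝓡 n) p).symm y)) (extChartAt (𝓡 n) p p)
        (chartRep p X (extChartAt (𝓡 n) p p)) := by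
  have h := (f.contMDiff.contMDiffAt (x := p)).mdifferentiableAt (by simp)
  have hf : mfderiv (𝓡 n) 𝓘(ℝ, ℝ) f p =
      fderiv ℝ (fun y => f ((extChartAt (𝓡 n) p).symm y)) (extChartAt (𝓡 n) p p) := by
    have := h.mfderiv
    rw [this]
    simp [writtenInExtChartAt, Function.comp_def, fderivWithin_univ]
    rfl
  rw [hf]
  exact congrArg _ (chartRep_self p X).symm

theorem partialDeriv_ofFun (i : Fin n) (f : Fun n M) (p : M) :
    partialDeriv i (ofFun f : RoughField n M) p = algebraMap ℝ _
      (fderiv ℝ (fun y => f ((extChartAt (𝓡 n) p).symm y)) (extChartAt (𝓡 n) p p)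
        (EuclideanSpace.single i 1)) := by
  have hd : DifferentiableAt ℝ (fun y => f ((extChartAt (𝓡 n) p).symm y))
      (extChartAt (𝓡 n) p p) :=
    (contDiffAt_comp_chart_symm f.contMDiff.contMDiffAt).differentiableAt (by simp)
  rw [Algebra.algebraMap_eq_smul_one, ← (extBasis n).sum_repr (1 : ExteriorAlgebra ℝ _),
    Finset.smul_sum, partialDeriv]
  refine Finset.sum_congr rfl fun S _ => ?_
  have e : (fun y => (extBasis n).coord S (localRep p (ofFun f : RoughField n M)
      ((extChartAt (𝓡 n) p).symm y))) = fun y => f ((extChartAt (𝓡 n) p).symm y) *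
      (extBasis n).coord S 1 := by
    funext y
    rw [localRep_ofFun, Algebra.algebraMap_eq_smul_one, map_smul, smul_eq_mul]
  rw [e, (hd.hasFDerivAt.mul_const _).fderiv, smul_smul]
  congr 1
  rw [smul_apply, smul_eq_mul, mul_comm, Module.Basis.coord_apply]

/-- The bracket of a vector field and a function is the derivative of the function. -/
theorem schouten_ofVF_ofFun (X : VF n M) (f : Fun n M) (p : M) :
    schouten (ofVF X : RoughField n M) (ofFun f : RoughField n M) p =
      algebraMap ℝ _ (show ℝ from mfderiv (𝓡 n) 𝓘(ℝ, ℝ) f p (X p)) := by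
  rw [schouten, map_symm_self]
  have h : ∀ i : Fin n, CliffordAlgebra.contractRight (localRep p (ofVF X : RoughField n M) p)
      (coordForm n i) * partialDeriv i (ofFun f : RoughField n M) p -
      partialDeriv i (ofVF X : RoughField n M) p * CliffordAlgebra.contractLeft (coordForm n i)
        (localRep p (ofFun f : RoughField n M) p) =
      algebraMap ℝ _ (coordForm n i (chartRep p X (extChartAt (𝓡 n) p p)) •
        fderiv ℝ (fun y => f ((extChartAt (𝓡 n) p).symm y)) (extChartAt (𝓡 n) p p)
          (EuclideanSpace.single i 1)) := by
    intro i
    rw [partialDeriv_ofFun, localRep_ofFun, localRep_ofVF_self]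
    have h1 := CliffordAlgebra.contractLeft_algebraMap
      (Q := (0 : QuadraticForm ℝ (EuclideanSpace ℝ (Fin n)))) (coordForm n i) (f p)
    have h2 := CliffordAlgebra.contractRight_ι
      (Q := (0 : QuadraticForm ℝ (EuclideanSpace ℝ (Fin n)))) (coordForm n i)
      (chartRep p X (extChartAt (𝓡 n) p p))
    erw [h1, h2]
    rw [mul_zero, sub_zero, smul_eq_mul, map_mul]
  rw [Finset.sum_congr rfl fun i _ => h i, ← map_sum, mfderiv_apply_eq_chartRep]
  exact congrArg _ (sum_coordForm_smul (fderiv ℝ (fun y => f ((extChartAt (𝓡 n) p).symm y))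
    (extChartAt (𝓡 n) p p)).toLinearMap (chartRep p X (extChartAt (𝓡 n) p p)))

theorem partialDeriv_ofVF (i : Fin n) (X : VF n M) (p : M) :
    partialDeriv i (ofVF X : RoughField n M) p = ExteriorAlgebra.ι ℝ
      (fderiv ℝ (chartRep p X) (extChartAt (𝓡 n) p p) (EuclideanSpace.single i 1)) := by
  rw [← (extBasis n).sum_repr (ExteriorAlgebra.ι ℝ _), partialDeriv]
  refine Finset.sum_congr rfl fun S _ => ?_
  have e : (fun y => (extBasis n).coord S (localRep p (ofVF X : RoughField n M)
      ((extChartAt (𝓡 n) p).symm y))) = fun y =>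
      (((extBasis n).coord S) ∘ₗ (ExteriorAlgebra.ι ℝ)).toContinuousLinearMap
        (chartRep p X y) := by
    funext y
    rw [localRep_ofVF]
    rfl
  have hd := (ContinuousLinearMap.hasFDerivAt
    (((extBasis n).coord S) ∘ₗ (ExteriorAlgebra.ι ℝ)).toContinuousLinearMap).comp _
    (differentiableAt_chartRep p X).hasFDerivAt
  rw [e]
  exact congrArg (fun g => g (EuclideanSpace.single i 1) • extBasis n S) hd.fderiv

/-- The pullback inverts the derivative of the inverse chart. That inverse is the derivative of the
chart, which is exactly the tangent bundle trivialization. -/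
theorem mpullbackWithin_eventuallyEq_chartRep (p : M) (Z : VF n M) :
    VectorField.mpullbackWithin 𝓘(ℝ, EuclideanSpace ℝ (Fin n)) (𝓡 n)
      (extChartAt (𝓡 n) p).symm Z (Set.range (𝓡 n)) =ᶠ[nhds (extChartAt (𝓡 n) p p)]
        chartRep p Z := by
  have : IsManifold (𝓡 n) 1 M := .of_le (n := ∞) (by simp)
  filter_upwards [extChartAt_target_mem_nhds (I := 𝓡 n) p] with y hy
  have hq : (extChartAt (𝓡 n) p).symm y ∈ (chartAt (EuclideanSpace ℝ (Fin n)) p).source := by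
    rw [← extChartAt_source (𝓡 n)]
    exact (extChartAt (𝓡 n) p).map_target hy
  have h := TangentBundle.continuousLinearMapAt_trivializationAt (I := 𝓡 n) hq
  have h2 := congrArg (fun g => g (Z ((extChartAt (𝓡 n) p).symm y))) h
  refine Eq.trans ?_ h2.symm
  exact DFunLike.congr_fun (ContinuousLinearMap.inverse_eq
    (mfderivWithin_extChartAt_symm_comp_mfderiv_extChartAt hy)
    (mfderiv_extChartAt_comp_mfderivWithin_extChartAt_symm hy)) (Z ((extChartAt (𝓡 n) p).symm y))

theorem mlieBracket_eq_chartRep (X Y : VF n M) (p : M) :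
    VectorField.mlieBracket (𝓡 n) X Y p = VectorField.lieBracket ℝ (chartRep p X) (chartRep p Y)
      (extChartAt (𝓡 n) p p) := by
  have : IsManifold (𝓡 n) 1 M := .of_le (n := ∞) (by simp)
  have h : ∀ v : EuclideanSpace ℝ (Fin n), (mfderiv (𝓡 n) 𝓘(ℝ, EuclideanSpace ℝ (Fin n))
      (extChartAt (𝓡 n) p) p).inverse v = v := by
    intro v
    rw [mfderiv_extChartAt_self]
    exact congrArg (fun g => g v) (ContinuousLinearMap.inverse_id (R := ℝ))
  rw [← VectorField.mlieBracketWithin_univ, VectorField.mlieBracketWithin_apply]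
  refine (h _).trans ?_
  refine (Filter.EventuallyEq.lieBracketWithin_vectorField_eq_nhds (𝕜 := ℝ)
    (mpullbackWithin_eventuallyEq_chartRep p X)
    (mpullbackWithin_eventuallyEq_chartRep p Y)).trans ?_
  simp [VectorField.lieBracketWithin_univ]

/-- On vector fields the Schouten-Nijenhuis bracket is the Lie bracket. -/
theorem schouten_ofVF_ofVF (X Y : VF n M) (p : M) :
    schouten (ofVF X : RoughField n M) (ofVF Y : RoughField n M) p =
      ExteriorAlgebra.ι ℝ (VectorField.mlieBracket (𝓡 n) X Y p) := by
  rw [schouten, map_symm_self, mlieBracket_eq_chartRep, VectorField.lieBracket]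
  have h : ∀ i : Fin n, CliffordAlgebra.contractRight (localRep p (ofVF X : RoughField n M) p)
      (coordForm n i) * partialDeriv i (ofVF Y : RoughField n M) p -
      partialDeriv i (ofVF X : RoughField n M) p * CliffordAlgebra.contractLeft (coordForm n i)
        (localRep p (ofVF Y : RoughField n M) p) =
      ExteriorAlgebra.ι ℝ (coordForm n i (chartRep p X (extChartAt (𝓡 n) p p)) •
          fderiv ℝ (chartRep p Y) (extChartAt (𝓡 n) p p) (EuclideanSpace.single i 1) -
        coordForm n i (chartRep p Y (extChartAt (𝓡 n) p p)) •
          fderiv ℝ (chartRep p X) (extChartAt (𝓡 n) p p) (EuclideanSpace.single i 1)) := by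
    intro i
    rw [partialDeriv_ofVF, partialDeriv_ofVF, localRep_ofVF_self, localRep_ofVF_self]
    have h1 := CliffordAlgebra.contractLeft_ι
      (Q := (0 : QuadraticForm ℝ (EuclideanSpace ℝ (Fin n)))) (coordForm n i)
      (chartRep p Y (extChartAt (𝓡 n) p p))
    have h2 := CliffordAlgebra.contractRight_ι
      (Q := (0 : QuadraticForm ℝ (EuclideanSpace ℝ (Fin n)))) (coordForm n i)
      (chartRep p X (extChartAt (𝓡 n) p p))
    erw [h1, h2]
    rw [map_sub, map_smul, map_smul, ← Algebra.commutes, Algebra.smul_def, Algebra.smul_def]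
  rw [Finset.sum_congr rfl fun i _ => h i, ← map_sum, Finset.sum_sub_distrib]
  have hY := sum_coordForm_smul (fderiv ℝ (chartRep p Y) (extChartAt (𝓡 n) p p)).toLinearMap
    (chartRep p X (extChartAt (𝓡 n) p p))
  have hX := sum_coordForm_smul (fderiv ℝ (chartRep p X) (extChartAt (𝓡 n) p p)).toLinearMap
    (chartRep p Y (extChartAt (𝓡 n) p p))
  exact congrArg _ (congrArg₂ _ hY hX)

/-! ### Homogeneous multivector fields: degrees zero and one, components -/

theorem isKVector_ofVF (X : VF n M) : IsKVector 1 (ofVF X) := fun p =>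
  ι_mem_exteriorPower (X p)

theorem IsKVector.mul {k l : ℕ} {X Y : MV n M} (hX : IsKVector k X) (hY : IsKVector l Y) :
    IsKVector (k + l) (X * Y) := fun p => mul_mem_exteriorPower (hX p) (hY p)

theorem ofVF_injective : Function.Injective (ofVF : VF n M → MV n M) := by
  intro X Y h
  refine ContMDiffSection.ext fun p => ?_
  have := congrFun (congrArg Subtype.val h) p
  exact (ExteriorAlgebra.ι_inj ℝ _ _).1 this

/-- The vector field given by the part of degree `1` of a multivector field. -/
def toVF (X : MV n M) : VF n M where
  toFun p := ExteriorAlgebra.ιInv (X.1 p)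
  contMDiff_toFun := by
    intro p₀
    have h1 : ContMDiffOn (𝓡 n) 𝓘(ℝ, EuclideanSpace ℝ (Fin n)) ∞ (fun q =>
        ∑ S, (extBasis n).coord S (localRep p₀ (X : RoughField n M) q) •
          ExteriorAlgebra.ιInv (extBasis n S)) (chartAt (EuclideanSpace ℝ (Fin n)) p₀).source :=
      contMDiffOn_finsetSum fun S _ => (X.2 p₀ S).smul contMDiffOn_const
    have h2 := ((trivializationAt (EuclideanSpace ℝ (Fin n))
      (TangentSpace (𝓡 n) : M → Type) p₀).contMDiffOn_section_baseSet_iff (IB := 𝓡 n)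
        (n := ∞) (s := fun q => ExteriorAlgebra.ιInv (X.1 q))).2 (h1.congr fun q hq => by
      -- `ιInv` is natural under linear maps, so it can be computed after trivializing, where it is
      -- a constant linear combination of the smooth components.
      have e := congrArg (fun g => g (X.1 q)) (ExteriorAlgebra.ιInv_comp_map
        ((trivializationAt (EuclideanSpace ℝ (Fin n))
          (TangentSpace (𝓡 n) : M → Type) p₀).linearMapAt ℝ q))
      have e2 : ∑ S, (extBasis n).coord S (localRep p₀ (X : RoughField n M) q) •
          ExteriorAlgebra.ιInv (extBasis n S) =
          ExteriorAlgebra.ιInv (localRep p₀ (X : RoughField n M) q) := by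
        conv_rhs => rw [← (extBasis n).sum_repr (localRep p₀ (X : RoughField n M) q)]
        simp only [map_sum, map_smul, Module.Basis.coord_apply]
      rw [e2]
      refine Eq.trans ?_ e.symm
      exact (congrFun (Bundle.Trivialization.coe_linearMapAt_of_mem (R := ℝ) _ hq) _).symm)
    exact h2.contMDiffAt ((chartAt (EuclideanSpace ℝ (Fin n)) p₀).open_source.mem_nhds
      (mem_chart_source _ p₀))

theorem ofVF_toVF {X : MV n M} (hX : IsKVector 1 X) : ofVF (toVF X) = X := by
  refine Subtype.ext (funext fun p => ?_)
  have h := hX p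
  rw [ExteriorAlgebra.exteriorPower, pow_one] at h
  obtain ⟨v, hv⟩ := h
  change ExteriorAlgebra.ι ℝ (ExteriorAlgebra.ιInv (X.1 p)) = X.1 p
  rw [← hv, ExteriorAlgebra.ι_leftInverse]

theorem exists_eq_ofFun {X : MV n M} (hX : IsKVector 0 X) : ∃ f : Fun n M, X = ofFun f := by
  have hloc : ∀ p₀ q : M, ExteriorAlgebra.algebraMapInv (X.1 q) =
      ExteriorAlgebra.algebraMapInv (localRep p₀ (X : RoughField n M) q) := by
    intro p₀ q
    have h := hX q
    rw [ExteriorAlgebra.exteriorPower, pow_zero] at h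
    obtain ⟨r, hr⟩ := Submodule.mem_one.1 h
    rw [localRep, ← hr, AlgHom.commutes, AlgHom.commutes, AlgHom.commutes]
  refine ⟨⟨fun q => ExteriorAlgebra.algebraMapInv (X.1 q), fun p₀ => ?_⟩,
    Subtype.ext (funext fun p => ?_)⟩
  · have h1 : ContMDiffOn (𝓡 n) 𝓘(ℝ, ℝ) ∞ (fun q =>
        ∑ S, (extBasis n).coord S (localRep p₀ (X : RoughField n M) q) *
          ExteriorAlgebra.algebraMapInv (extBasis n S))
        (chartAt (EuclideanSpace ℝ (Fin n)) p₀).source :=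
      contMDiffOn_finsetSum fun S _ => (X.2 p₀ S).mul contMDiffOn_const
    refine (h1.congr fun q hq => ?_).contMDiffAt
      ((chartAt (EuclideanSpace ℝ (Fin n)) p₀).open_source.mem_nhds (mem_chart_source _ p₀))
    rw [hloc p₀ q]
    conv_lhs => rw [← (extBasis n).sum_repr (localRep p₀ (X : RoughField n M) q)]
    simp only [map_sum, map_smul, smul_eq_mul, Module.Basis.coord_apply]
  · have h := hX p
    rw [ExteriorAlgebra.exteriorPower, pow_zero] at h
    obtain ⟨r, hr⟩ := Submodule.mem_one.1 h
    change X.1 p = algebraMap ℝ _ (ExteriorAlgebra.algebraMapInv (X.1 p))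
    rw [← hr, ExteriorAlgebra.algebraMap_leftInverse]

/-- The part of degree `k` of a multivector field. -/
def component (k : ℕ) (X : MV n M) : MV n M :=
  ⟨fun p => degreeProj _ k (X.1 p), by
    intro p₀ S
    have h : (fun q => (extBasis n).coord S (localRep p₀
        (fun p => degreeProj (TangentSpace (𝓡 n) p) k (X.1 p)) q)) = fun q =>
        ∑ A, (extBasis n).coord A (localRep p₀ (X : RoughField n M) q) *
          (extBasis n).coord S (degreeProj _ k (extBasis n A)) := by
      funext q
      have e : localRep p₀ (fun p => degreeProj (TangentSpace (𝓡 n) p) k (X.1 p)) q =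
          degreeProj _ k (localRep p₀ (X : RoughField n M) q) := map_degreeProj _ _ _
      rw [e]
      conv_lhs => rw [← (extBasis n).sum_repr (localRep p₀ (X : RoughField n M) q)]
      simp only [map_sum, map_smul, smul_eq_mul, Module.Basis.coord_apply]
    rw [h]
    exact contMDiffOn_finsetSum fun A _ => (X.2 p₀ A).mul contMDiffOn_const⟩

theorem isKVector_component (k : ℕ) (X : MV n M) : IsKVector k (component k X) :=
  fun p => degreeProj_mem k (X.1 p)

theorem sum_component (X : MV n M) : ∑ k ∈ Finset.range (n + 1), component k X = X := by
  refine Subtype.ext (funext fun p => ?_)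
  rw [AddSubmonoidClass.coe_finsetSum, Finset.sum_apply]
  exact sum_degreeProj (n := n) (X.1 p)

/-- Torsion-freeness speaks only of homogeneous fields, whereas the product rules allow an arbitrary
last argument; this bridges the two. -/
theorem homogeneous_induction {P : MV n M → Prop}
    (hom : ∀ (k : ℕ) (X : MV n M), IsKVector k X → P X) (add : ∀ X Y, P X → P Y → P (X + Y))
    (X : MV n M) : P X := by
  rw [← sum_component X]
  exact Finset.sum_induction _ P add (hom 0 0 fun p => Submodule.zero_mem _)
    fun k _ => hom k _ (isKVector_component k X)

/-! ### Multivectors as values of products of global vector fields -/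

/-- Every tangent vector is a value of a smooth vector field. -/
theorem exists_vectorField_apply_eq [T2Space M] (p : M) (v : TangentSpace (𝓡 n) p) :
    ∃ X : VF n M, X p = v := by
  obtain ⟨s, hs, hsm⟩ := FiberBundle.exists_contMDiffOn_extend (k := ∞) (𝓡 n)
    (EuclideanSpace ℝ (Fin n)) v
  -- A bump function supported where the local extension of `v` is smooth makes it global.
  obtain ⟨χ, -, hχ⟩ := (SmoothBumpFunction.nhds_basis_tsupport (I := 𝓡 n) p).mem_iff.1
    (interior_mem_nhds.2 hs)
  refine ⟨⟨_, ContMDiffOn.smul_section_of_tsupport χ.contMDiff.contMDiffOn isOpen_interior hχ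
    (hsm.mono interior_subset)⟩, ?_⟩
  change χ p • FiberBundle.extend (EuclideanSpace ℝ (Fin n)) v p = v
  rw [FiberBundle.extend_apply_self, χ.eq_one, one_smul]

theorem exists_isKVector_apply_eq_prod [T2Space M] (p : M) {k : ℕ}
    (v : Fin k → TangentSpace (𝓡 n) p) :
    ∃ L : List (VF n M), L.length = k ∧
      ((L.map ofVF).prod : MV n M).1 p = ExteriorAlgebra.ιMulti ℝ k v := by
  induction k with
  | zero => exact ⟨[], rfl, by simp⟩
  | succ k ih =>
    obtain ⟨L, hL, h⟩ := ih (Matrix.vecTail v)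
    obtain ⟨X, hX⟩ := exists_vectorField_apply_eq p (v 0)
    refine ⟨X :: L, by simp [hL], ?_⟩
    rw [ExteriorAlgebra.ιMulti_succ_apply, ← h, ← hX, List.map_cons, List.prod_cons]
    rfl

theorem isKVector_prod (L : List (VF n M)) : IsKVector L.length (L.map ofVF).prod := by
  induction L with
  | nil =>
    intro p
    rw [ExteriorAlgebra.exteriorPower, List.length_nil, pow_zero]
    exact Submodule.one_le.1 le_rfl
  | cons X L ih =>
    rw [List.map_cons, List.prod_cons, List.length_cons, add_comm]
    exact (isKVector_ofVF X).mul ih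

end

/-! ### Exchanging the two product rules by torsion-freeness -/

/-- Read `xyz` as `∇_{X∧Y} Z`, `zxy` as `∇_Z (X∧Y)`, `yz` as `∇_Y Z`, and so on, with the `b`'s as
brackets. After substitution the terms in `x * zy` and `zx * y` cancel by `c1` and `c2`, and `c3`
gives the sign of the one term left to commute. -/
theorem lower_identity {A : Type*} [Ring A] [Algebra ℝ A] (k l m : ℤ)
    {x y xyz zxy yz xz zy zx : A} (bXYZ bYZ bXZ : A)
    (t1 : xyz - sgn ((k + l - 1) * (m - 1)) • zxy = bXYZ)
    (t2 : yz - sgn ((l - 1) * (m - 1)) • zy = bYZ)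
    (t3 : xz - sgn ((k - 1) * (m - 1)) • zx = bXZ)
    (hb : bXYZ = x * bYZ + sgn (l * (m - 1)) • (bXZ * y))
    (hu : zxy = zx * y + sgn ((m - 1) * k) • (x * zy))
    (hc : xz * y = sgn ((k + m - 1) * l) • (y * xz)) :
    xyz = x * yz + sgn (k * l) • (y * xz) := by
  have c1 : sgn ((k + l - 1) * (m - 1)) * sgn ((m - 1) * k) = sgn ((l - 1) * (m - 1)) := by
    rw [← sgn_add]; exact sgn_congr ⟨(m - 1) * k, by ring⟩
  have c2 : sgn (l * (m - 1)) * sgn ((k - 1) * (m - 1)) = sgn ((k + l - 1) * (m - 1)) := by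
    rw [← sgn_add]; exact sgn_congr ⟨0, by ring⟩
  have c3 : sgn (l * (m - 1)) * sgn ((k + m - 1) * l) = sgn (k * l) := by
    rw [← sgn_add]; exact sgn_congr ⟨(m - 1) * l, by ring⟩
  rw [sub_eq_iff_eq_add] at t1
  rw [t1, hb, ← t2, ← t3, hu, sub_mul xz, hc, mul_sub x, smul_sub, smul_mul_assoc, mul_smul_comm,
    smul_add, smul_smul, smul_smul, smul_smul, c1, c2, c3]
  abel

/-- Here `xyz` is `∇_X (Y∧Z)` and `yzx` is `∇_{Y∧Z} X`. Starting from the torsion of `(Y∧Z, X)`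
keeps the product in the first slot of the bracket, so the same Leibniz rule applies; the terms in
`y * zx` and `z * yx` cancel. -/
theorem upper_identity {A : Type*} [Ring A] [Algebra ℝ A] (k l m : ℤ)
    {y z yzx xyz zx xz yx xy : A} (bYZX bZX bYX : A)
    (t1 : yzx - sgn ((l + m - 1) * (k - 1)) • xyz = bYZX)
    (t2 : zx - sgn ((m - 1) * (k - 1)) • xz = bZX)
    (t3 : yx - sgn ((l - 1) * (k - 1)) • xy = bYX)
    (hb : bYZX = y * bZX + sgn (m * (k - 1)) • (bYX * z))
    (hl : yzx = y * zx + sgn (l * m) • (z * yx))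
    (hc : yx * z = sgn ((l + k - 1) * m) • (z * yx)) :
    xyz = xy * z + sgn ((k - 1) * l) • (y * xz) := by
  have c1 : sgn (m * (k - 1)) * sgn ((l + k - 1) * m) = sgn (l * m) := by
    rw [← sgn_add]; exact sgn_congr ⟨m * (k - 1), by ring⟩
  have c2 : sgn ((l + m - 1) * (k - 1)) * sgn ((m - 1) * (k - 1)) = sgn ((k - 1) * l) := by
    rw [← sgn_add]; exact sgn_congr ⟨(m - 1) * (k - 1), by ring⟩
  have c3 : sgn (m * (k - 1)) * sgn ((l - 1) * (k - 1)) = sgn ((l + m - 1) * (k - 1)) := by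
    rw [← sgn_add]; exact sgn_congr ⟨0, by ring⟩
  have e : sgn ((l + m - 1) * (k - 1)) • xyz =
      sgn ((m - 1) * (k - 1)) • (y * xz) + sgn ((l + m - 1) * (k - 1)) • (xy * z) := by
    rw [sub_eq_iff_eq_add, ← sub_eq_iff_eq_add'] at t1
    rw [← t1, hl, hb, ← t2, ← t3, sub_mul yx, hc, mul_sub y, smul_sub, smul_mul_assoc,
      mul_smul_comm, smul_smul, smul_smul, c1, c3]
    abel
  have e2 := congrArg (fun a => sgn ((l + m - 1) * (k - 1)) • a) e
  simp only [smul_add, smul_smul, sgn_mul_self, one_smul, c2] at e2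
  rw [e2, add_comm]

section

variable {n : ℕ} {M : Type*} [TopologicalSpace M]
  [ChartedSpace (EuclideanSpace ℝ (Fin n)) M] [IsManifold (𝓡 n) ∞ M]

namespace HigherConnection

theorem nabla_add_left (C : HigherConnection n M) (X X' Y : MV n M) :
    C.nabla (X + X') Y = C.nabla X Y + C.nabla X' Y := by
  have h := C.linear_left 1 X X' Y
  have h1 : (ofFun 1 : MV n M) = 1 := Subtype.ext (funext fun p => map_one _)
  simpa only [h1, one_mul] using h

theorem nabla_mul_left (C : HigherConnection n M) (f : Fun n M) (X Y : MV n M) :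
    C.nabla (ofFun f * X) Y = ofFun f * C.nabla X Y := by
  have h := C.nabla_add_left 0 0 Y
  have h2 := C.linear_left f X 0 Y
  rw [add_zero, left_eq_add] at h
  rwa [add_zero, h, add_zero] at h2

theorem nabla_mul_eq_sgn_smul (C : HigherConnection n M) {k l m : ℕ} {X Y Z : MV n M}
    (hX : IsKVector k X) (hY : IsKVector l Y) (hZ : IsKVector m Z) :
    (C.nabla X Z : RoughField n M) * (Y : RoughField n M) =
      sgn (((k : ℤ) + m - 1) * l) • ((Y : RoughField n M) * (C.nabla X Z : RoughField n M)) := by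
  -- When `k = m = 0` there is no degree `k + m - 1`; then `X` is a function and `∇_X Z = 0`.
  rcases Nat.eq_zero_or_pos (k + m) with h | h
  · obtain rfl : k = 0 := by omega
    obtain ⟨f, rfl⟩ := exists_eq_ofFun hX
    rw [C.fun_left]
    simp
  · funext p
    have e := mul_eq_sgn_smul (C.degree k m X Z hX hZ h p) (hY p)
    rw [Nat.cast_sub h] at e
    push_cast at e
    exact e

theorem IsUpperInduced.isLowerInduced {C : HigherConnection n M} (hU : C.IsUpperInduced)
    (hT : C.IsTorsionFree) : C.IsLowerInduced := by
  intro k l X Y Z hX hY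
  induction Z using homogeneous_induction with
  | add Z Z' h h' =>
    rw [C.add_right, h, h', C.add_right, C.add_right, mul_add, mul_add, smul_add]
    abel
  | hom m Z hZ =>
    refine Subtype.ext ?_
    have t1 := sub_eq_zero.1 (hT (k + l) m (X * Y) Z (hX.mul hY) hZ)
    push_cast at t1
    exact lower_identity (A := RoughField n M) k l m _ _ _ t1
      (sub_eq_zero.1 (hT l m Y Z hY hZ)) (sub_eq_zero.1 (hT k m X Z hX hZ))
      (schouten_mul_left X hY hZ) (congrArg Subtype.val (hU m k Z X Y hZ hX))
      (C.nabla_mul_eq_sgn_smul hX hY hZ)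

theorem IsLowerInduced.isUpperInduced {C : HigherConnection n M} (hL : C.IsLowerInduced)
    (hT : C.IsTorsionFree) : C.IsUpperInduced := by
  intro k l X Y Z hX hY
  induction Z using homogeneous_induction with
  | add Z Z' h h' =>
    rw [mul_add, C.add_right, h, h', C.add_right, mul_add, mul_add, smul_add]
    abel
  | hom m Z hZ =>
    refine Subtype.ext ?_
    have t1 := sub_eq_zero.1 (hT (l + m) k (Y * Z) X (hY.mul hZ) hX)
    push_cast at t1
    exact upper_identity (A := RoughField n M) k l m _ _ _ t1
      (sub_eq_zero.1 (hT m k Z X hZ hX)) (sub_eq_zero.1 (hT l k Y X hY hX))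
      (schouten_mul_left Y hZ hX) (congrArg Subtype.val (hL l m Y Z X hY hZ))
      (C.nabla_mul_eq_sgn_smul hY hZ hX)

theorem ofVF_toVF_nabla (C : HigherConnection n M) (X Y : VF n M) :
    ofVF (toVF (C.nabla (ofVF X) (ofVF Y))) = C.nabla (ofVF X) (ofVF Y) :=
  ofVF_toVF (C.degree 1 1 _ _ (isKVector_ofVF X) (isKVector_ofVF Y) (by norm_num))

end HigherConnection

/-! ### The affine connection underlying a higher connection -/

theorem ofVF_add (X Y : VF n M) : ofVF (X + Y) = ofVF X + ofVF Y :=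
  Subtype.ext (funext fun p => map_add _ (X p) (Y p))

theorem ofVF_of_forall_eq_smul {f : Fun n M} {X Y : VF n M} (h : ∀ p, Y p = f p • X p) :
    ofVF Y = ofFun f * ofVF X := by
  refine Subtype.ext (funext fun p => ?_)
  change ExteriorAlgebra.ι ℝ (Y p) = algebraMap ℝ _ (f p) * ExteriorAlgebra.ι ℝ (X p)
  rw [h, map_smul, Algebra.smul_def]

theorem ι_apply_eq_of_ofVF_eq {X : VF n M} {Y : MV n M} (h : ofVF X = Y) (p : M) :
    ExteriorAlgebra.ι ℝ (X p) = Y.1 p := by rw [← h]; rfl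

/-- The restriction of a higher connection to vector fields. -/
def HigherConnection.toAffineConnection (C : HigherConnection n M) : AffineConnection n M where
  nabla X Y := toVF (C.nabla (ofVF X) (ofVF Y))
  add_left X X' Y := ofVF_injective (by
    rw [ofVF_add (toVF _), C.ofVF_toVF_nabla, C.ofVF_toVF_nabla, C.ofVF_toVF_nabla, ofVF_add,
      C.nabla_add_left])
  smul_left f X fX Y h p := by
    have e := C.ofVF_toVF_nabla fX Y
    have e' := ι_apply_eq_of_ofVF_eq (C.ofVF_toVF_nabla X Y) p
    rw [ofVF_of_forall_eq_smul h, C.nabla_mul_left] at e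
    refine (ExteriorAlgebra.ι_inj ℝ _ _).1 ?_
    rw [map_smul, e', Algebra.smul_def, ofVF_of_forall_eq_smul h, C.nabla_mul_left]
    exact ι_apply_eq_of_ofVF_eq e p
  add_right X Y Y' := ofVF_injective (by
    rw [ofVF_add (toVF _), C.ofVF_toVF_nabla, C.ofVF_toVF_nabla, C.ofVF_toVF_nabla, ofVF_add,
      C.add_right])
  leibniz f X Y fY h p := by
    have e := ι_apply_eq_of_ofVF_eq (C.ofVF_toVF_nabla X fY) p
    have e' := ι_apply_eq_of_ofVF_eq (C.ofVF_toVF_nabla X Y) p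
    refine (ExteriorAlgebra.ι_inj ℝ _ _).1 ?_
    rw [e, map_add, map_smul, map_smul, e', ofVF_of_forall_eq_smul h]
    have h3 := congrFun (C.leibniz 1 (ofVF X) f (ofVF Y) (isKVector_ofVF X)) p
    refine h3.trans ?_
    rw [Pi.add_apply, Pi.mul_apply, schouten_ofVF_ofFun, Algebra.smul_def, Algebra.smul_def]
    rfl

theorem HigherConnection.IsTorsionFree.toAffineConnection {C : HigherConnection n M}
    (hT : C.IsTorsionFree) : C.toAffineConnection.IsTorsionFree := by
  intro X Y p
  have h := congrFun (hT 1 1 (ofVF X) (ofVF Y) (isKVector_ofVF X) (isKVector_ofVF Y)) p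
  have e : ∀ X Y : VF n M, ExteriorAlgebra.ι ℝ (C.toAffineConnection.nabla X Y p) =
      (C.nabla (ofVF X) (ofVF Y)).1 p :=
    fun X Y => ι_apply_eq_of_ofVF_eq (C.ofVF_toVF_nabla X Y) p
  rw [← ExteriorAlgebra.ι_eq_zero_iff (R := ℝ), map_sub, map_sub, e, e, ← schouten_ofVF_ofVF]
  refine Eq.trans ?_ h
  change _ = (C.nabla (ofVF X) (ofVF Y)).1 p - sgn _ • (C.nabla (ofVF Y) (ofVF X)).1 p - _
  simp [sgn]

/-! ### Uniqueness of the associated pair -/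

namespace HigherConnection

/-- Two induced higher connections which agree on vector fields agree on products of vector
fields. -/
theorem nabla_prod_eq {C C' : HigherConnection n M} (hL : C.IsLowerInduced) (hU : C.IsUpperInduced)
    (hL' : C'.IsLowerInduced) (hU' : C'.IsUpperInduced)
    (h : ∀ X Y : VF n M, C.nabla (ofVF X) (ofVF Y) = C'.nabla (ofVF X) (ofVF Y))
    (L L' : List (VF n M)) :
    C.nabla (L.map ofVF).prod (L'.map ofVF).prod =
      C'.nabla (L.map ofVF).prod (L'.map ofVF).prod := by
  have h1 : (1 : MV n M) = ofFun 1 := Subtype.ext (funext fun p => (map_one _).symm)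
  -- The lower rule peels factors off the first argument, down to the empty product: the function
  -- `1`, along which every higher connection vanishes.
  have hvf : ∀ Y : VF n M, C.nabla (L.map ofVF).prod (ofVF Y) =
      C'.nabla (L.map ofVF).prod (ofVF Y) := by
    intro Y
    induction L with
    | nil => rw [List.map_nil, List.prod_nil, h1, C.fun_left, C'.fun_left]
    | cons X L ih =>
      rw [List.map_cons, List.prod_cons, hL _ _ _ _ _ (isKVector_ofVF X) (isKVector_prod L),
        hL' _ _ _ _ _ (isKVector_ofVF X) (isKVector_prod L), ih, h]
  induction L' with
  | nil =>
    refine Subtype.ext ?_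
    -- On the function `1` both connections equal the same bracket.
    rw [List.map_nil, List.prod_nil, h1, C.fun_right _ _ _ (isKVector_prod L),
      C'.fun_right _ _ _ (isKVector_prod L)]
  | cons Y L' ih =>
    rw [List.map_cons, List.prod_cons, hU _ _ _ _ _ (isKVector_prod L) (isKVector_ofVF Y),
      hU' _ _ _ _ _ (isKVector_prod L) (isKVector_ofVF Y), ih, hvf]

/-- A twist field depends only on values at `p`, so it is enough to test it on decomposable
multivectors. These are values of products of global vector fields, where the two connections agree.
-/
theorem twist_eq_zero [T2Space M] {C C' : HigherConnection n M} (hL : C.IsLowerInduced)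
    (hU : C.IsUpperInduced) (hL' : C'.IsLowerInduced) (hU' : C'.IsUpperInduced)
    (h : ∀ X Y : VF n M, C.nabla (ofVF X) (ofVF Y) = C'.nabla (ofVF X) (ofVF Y))
    {F : TwistData n M}
    (hF : ∀ (k l : ℕ) (X Y : MV n M) (hX : IsKVector k X) (hY : IsKVector l Y) (p : M),
      (C.nabla X Y).1 p =
        (C'.nabla X Y).1 p + (F.twist k l p ⟨X.1 p, hX p⟩ ⟨Y.1 p, hY p⟩ : Multivector n p))
    (k l : ℕ) (p : M) : F.twist k l p = 0 := by
  refine LinearMap.ext_on (exteriorPower.ιMulti_span ℝ k (TangentSpace (𝓡 n) p)) ?_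
  rintro _ ⟨v, rfl⟩
  refine LinearMap.ext_on (exteriorPower.ιMulti_span ℝ l (TangentSpace (𝓡 n) p)) ?_
  rintro _ ⟨w, rfl⟩
  obtain ⟨L, rfl, hv⟩ := exists_isKVector_apply_eq_prod p v
  obtain ⟨L', rfl, hw⟩ := exists_isKVector_apply_eq_prod p w
  have e := hF _ _ _ _ (isKVector_prod L) (isKVector_prod L') p
  rw [nabla_prod_eq hL hU hL' hU' h, left_eq_add] at e
  have ev : exteriorPower.ιMulti ℝ L.length v = ⟨_, isKVector_prod L p⟩ := Subtype.ext hv.symm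
  have ew : exteriorPower.ιMulti ℝ L'.length w = ⟨_, isKVector_prod L' p⟩ := Subtype.ext hw.symm
  refine Eq.trans (congrArg₂ (fun a b => F.twist L.length L'.length p a b) ev ew) ?_
  exact ZeroMemClass.coe_eq_zero.1 e

end HigherConnection

theorem AffineConnection.ext_nabla {D D' : AffineConnection n M} (h : D.nabla = D'.nabla) :
    D = D' := by
  cases D; cases D'; cases h; rfl

end

end HigherConn

end

theorem mainTheorem5 {n : ℕ} {M : Type*} [TopologicalSpace M] [T2Space M]
    [SecondCountableTopology M] [ChartedSpace (EuclideanSpace ℝ (Fin n)) M]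
    [IsManifold (𝓡 n) ∞ M] (C : HigherConn.HigherConnection n M)
    (hC : C.IsUpperInduced ∨ C.IsLowerInduced) (hT : C.IsTorsionFree) :
    ∃ D : HigherConn.AffineConnection n M, D.IsTorsionFree ∧ C.IsInducedBy D ∧
      ∀ (D' : HigherConn.AffineConnection n M) (F : HigherConn.TwistData n M),
        C.IsAssociated D' F ↔ D' = D ∧ ∀ (k l : ℕ) (p : M), F.twist k l p = 0 := by
  have hU : C.IsUpperInduced := hC.elim id fun h => h.isUpperInduced hT
  have hL : C.IsLowerInduced := hC.elim (fun h => h.isLowerInduced hT) id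
  have hD : C.IsInducedBy C.toAffineConnection :=
    ⟨hL, hU, fun X Y => (C.ofVF_toVF_nabla X Y).symm⟩
  refine ⟨C.toAffineConnection, hT.toAffineConnection, hD, fun D' F => ⟨?_, ?_⟩⟩
  · rintro ⟨C', ⟨hL', hU', hD'⟩, hF⟩
    have h : ∀ X Y : HigherConn.VF n M, C.nabla (HigherConn.ofVF X) (HigherConn.ofVF Y) =
        C'.nabla (HigherConn.ofVF X) (HigherConn.ofVF Y) := by
      intro X Y
      refine Subtype.ext (funext fun p => ?_)
      rw [hF 1 1 _ _ (HigherConn.isKVector_ofVF X) (HigherConn.isKVector_ofVF Y) p, F.one_one]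
      exact add_zero _
    refine ⟨HigherConn.AffineConnection.ext_nabla ?_,
      HigherConn.HigherConnection.twist_eq_zero hL hU hL' hU' h hF⟩
    funext X Y
    refine HigherConn.ofVF_injective ?_
    rw [← hD' X Y, ← h, hD.2.2 X Y]
  · rintro ⟨rfl, hF⟩
    -- `C` itself serves as the higher connection induced by `D`, so none has to be constructed from
    -- `D`.
    refine ⟨C, hD, fun k l X Y hX hY p => ?_⟩
    rw [hF k l p]
    exact (add_zero _).symm
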